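/- **Setting.** A mechanism with outputs in a measurable space $\mathcal Z$ is a family of Markov kernels $\mathcal M(x,z)$ on $\mathcal Z$, where $x\in[-1,1]$ is the value of a user and $z=(z_1,\dots,z_n)\in\mathcal Z^n$ ($n\ge 0$) is the list of the outputs revealed so far. It is $\epsilon$-locally differentially private if $\Pr\{\mathcal M(x,z)\in S\}\le e^{\epsilon}\Pr\{\mathcal M(x',z)\in S\}$ for all $x,x'\in[-1,1]$, all $z$ and all measurable $S\subseteq\mathcal Z$. The $N$ users have i.i.d. values $x_1,\dots,x_N$ with cumulative distribution function $F$ supported on $[-1,1]$; user $i$ outputs $z_i\sim\mathcal M(x_i,(z_1,\dots,z_{i-1}))$, and a measurable estimator $\tilde x=\tilde x(z_1,\dots,z_N)\in\mathbb R$ has the error $\mathrm{Err}=\mathbb E|x_{\min}-\tilde x|\in[0,\infty]$, where $x_{\min}=\inf\{x\in[-1,1]:F(x)>0\}$. $F$ is $\alpha$-fat with constants $C>0$ and $\bar x\in[-1,1]$, $\bar x>x_{\min}$, if $F(x)\ge C(x-x_{\min})^{\alpha}$ for all $x_{\min}<x<\bar x$. **Theorem.** Let $\alpha>0$ and $C>0$.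 There are constants $c>0$ and $h>0$ depending only on $\alpha$ and $C$ such that the following hold. 1. For every $\epsilon\in[0,22/35]$, every $N\ge 0$, every $\epsilon$-locally differentially private mechanism and every estimator, there is an $F$ that is $\alpha$-fat with constants $C$ and some $\bar x\ge x_{\min}+h$, such that $$\mathrm{Err}\ \ge\ c\left(\frac{1}{\max\{1,\epsilon^2N\}}\right)^{1/(2\alpha)}.$$ In particular $\mathrm{Err}\ge c\,(1/(\epsilon^2N))^{1/(2\alpha)}$ whenever $\epsilon^2N\ge1$. 2. For all sequences $\epsilon_k\in[0,22/35]$ and $N_k\ge 0$ (in particular, for $N_k$ increasing and $\epsilon_k$ decreasing), and every sequence of $\epsilon_k$-locally differentially private mechanisms with estimators for $N_k$ users, there is a single $F$ that is $\alpha$-fat with constants $C$ and some $\bar x\ge x_{\min}+h$, such that, for infinitely many $k$, $$\mathrm{Err}_k\ \ge\ c\left(\frac{1}{\max\{1,\epsilon_k^2N_k\}}\right)^{1/(2\alpha)}.$$ -/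

import Mathlib

open MeasureTheory ProbabilityTheory Filter
open scoped ENNReal

noncomputable section

namespace LocalMin

/-- The data domain `[-1, 1]` of a single user. -/
abbrev Data : Type := Set.Icc (-1 : ℝ) 1

/-- The cumulative distribution function of a user data distribution on `[-1, 1]`. -/
def dataCDF (μ : Measure Data) : StieltjesFunction ℝ :=
  cdf (μ.map (Subtype.val : Data → ℝ))

/-- The minimum of the distribution, `inf {x ∈ [-1, 1] : F x > 0}`. -/
def xMin (μ : Measure Data) : ℝ :=
  sInf {x : ℝ | x ∈ Set.Icc (-1 : ℝ) 1 ∧ 0 < dataCDF μ x}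

/-- `α`-fatness with the constants `C` and `xbar`. The point `xbar` lies strictly to the right of
the minimum, so that the condition on `F` is not void. -/
structure IsFat (α C xbar : ℝ) (μ : Measure Data) : Prop where
  alpha_pos : 0 < α
  const_pos : 0 < C
  mem_Icc : xbar ∈ Set.Icc (-1 : ℝ) 1
  xMin_lt : xMin μ < xbar
  le_cdf : ∀ x : ℝ, xMin μ < x → x < xbar → C * (x - xMin μ) ^ α ≤ dataCDF μ x

/-- An interactive mechanism with outputs in `Z`: a probabilistic map that sends the value of a user
together with the finite list of the outputs revealed so far to an output in `Z`. -/
structure Mechanism (Z : Type*) [MeasurableSpace Z] where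
  /-- the channel used when `n` outputs have already been revealed -/
  channel : ∀ n : ℕ, Kernel (Data × (Fin n → Z)) Z
  markov : ∀ n : ℕ, IsMarkovKernel (channel n)

namespace Mechanism

variable {Z : Type*} [MeasurableSpace Z]

/-- `ε`-local differential privacy. -/
def IsLDP (M : Mechanism Z) (ε : ℝ) : Prop :=
  ∀ (n : ℕ) (x x' : Data) (z : Fin n → Z) (S : Set Z), MeasurableSet S →
    M.channel n (x, z) S ≤ ENNReal.ofReal (Real.exp ε) * M.channel n (x', z) S

/-- The law of the outputs of the first `n` users when the values of the users are drawn
independently from `μ`: the value of the next user is independent of the outputs revealed so far,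
and the new output, drawn from the channel, is appended to them. -/
def transcript (M : Mechanism Z) (μ : Measure Data) : ∀ n : ℕ, Measure (Fin n → Z)
  | 0 => Measure.dirac Fin.elim0
  | n + 1 => ((μ.prod (M.transcript μ n)) ⊗ₘ M.channel n).map
      (fun p => (Fin.snoc p.1.2 p.2 : Fin (n + 1) → Z))

/-- The mean absolute error `E |x_min - est (z_1, …, z_N)|` for `N` users with i.i.d. data from `μ`,
with values in `[0, ∞]`. -/
def err (M : Mechanism Z) (μ : Measure Data) {N : ℕ} (est : (Fin N → Z) → ℝ) : ℝ≥0∞ :=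
  ∫⁻ z, ENNReal.ofReal |xMin μ - est z| ∂(M.transcript μ N)

end Mechanism

/-- The rate `(1 / (ε² N)) ^ (1 / (2 α))`, capped at `1` when `ε² N < 1` (the error of a
minimum in `[-1, 1]` is bounded, so no larger rate is possible there). -/
def rate (α ε : ℝ) (N : ℕ) : ℝ :=
  (1 / max 1 (ε ^ 2 * (N : ℝ))) ^ (1 / (2 * α))

end LocalMin

end

universe u

/-!
Two distributions whose minima differ by `Δ` can share all but a mass of order `Δ ^ α` and still be
`α`-fat. Local privacy turns a difference `τ` in mass into likelihood ratios of the outputs within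
`1 ± (exp ε - 1) * τ` (`Mechanism.output_map_le`). Since a likelihood ratio has mean `1`, its second
moment is then `1` up to a term of order `(ε * τ) ^ 2`, and this bound multiplies along the
transcript (`Mechanism.sq_lintegral_transcript_le`). Hence `N` users cannot tell the two
distributions apart when `ε ^ 2 * N * Δ ^ (2 * α)` is below a constant, and by Le Cam's argument
(`ofReal_le_lintegral_abs_or`) the error is of order `Δ` at one of them. The choice
`Δ ≈ (ε ^ 2 * N) ^ (-1 / (2 * α))` gives the rate. The comparison of transcripts is written as an
inequality between integrals of test functions, so no assumption on the output space is needed.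

For a single distribution that is bad for infinitely many estimators, the pairs have to be available
around a common distribution and at all scales. The family `dyadicLaw` is indexed by binary digits
`b`: the minimum is (a multiple of) the number with digits `b`, and atoms with geometric masses sit
at the right ends of the dyadic intervals containing it. The atoms accumulate at the minimum, which
makes the law fat, while flipping the digit `j` moves the minimum by about `2 ^ (-j)` and affects
only the atoms of level greater than `j`, of total mass `2 ^ (-α * (j + 1))`. The error of every
estimator is lower semicontinuous in `b`. If all errors were eventually small at every `b`, then by
Baire's theorem they would be small from some index on throughout an open set of digit sequences,
which contains pairs that differ in a single late digit; this contradicts the two-point bound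
(`exists_frequently_le_of_flipDigit`). If the scales do not tend to zero, one pair is used infinitely
often, and one of its two points works.
-/

open scoped NNReal

namespace LocalMin

/-! ### Nearly equal measures: a second-moment comparison -/

section NearlyEqual

variable {α : Type*} [MeasurableSpace α]

theorem sq_lintegral_mul_le (μ : Measure α) {f g : α → ℝ≥0∞} (hf : Measurable f)
    (hg : Measurable g) :
    (∫⁻ a, f a * g a ∂μ) ^ 2 ≤ (∫⁻ a, f a ^ 2 ∂μ) * ∫⁻ a, g a ^ 2 ∂μ := by
  have h := ENNReal.lintegral_mul_le_Lp_mul_Lq μ Real.HolderConjugate.two_two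
    hf.aemeasurable hg.aemeasurable
  have hs : ∀ x : ℝ≥0∞, (x ^ (1 / 2 : ℝ)) ^ 2 = x := fun x ↦ by
    rw [← ENNReal.rpow_natCast, ← ENNReal.rpow_mul]; norm_num
  simp only [ENNReal.rpow_ofNat, Pi.mul_apply] at h
  calc _ ≤ _ := pow_le_pow_left' h 2
    _ = _ := by rw [mul_pow, hs, hs]

/-- If the density of `Q` with respect to `Q'` deviates from `1` by at most `η`, its second moment
is at most `1 + η ^ 2`, because its mean is `1`. The loss is of second order in `η`, which is what
makes `N` users cost a factor `(1 + η ^ 2) ^ N` only. -/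
theorem sq_lintegral_le_of_le_smul {Q Q' : Measure α} [IsProbabilityMeasure Q]
    [IsProbabilityMeasure Q'] {η : ℝ≥0} (h : Q ≤ (1 + η) • Q') (h' : Q' ≤ (1 + η) • Q)
    {f : α → ℝ≥0∞} (hf : Measurable f) :
    (∫⁻ a, f a ∂Q) ^ 2 ≤ ((1 + η ^ 2 : ℝ≥0) : ℝ≥0∞) * ∫⁻ a, f a ^ 2 ∂Q' := by
  have hac : Q ≪ Q' := Measure.absolutelyContinuous_of_le_smul h
  set r := Q.rnDeriv Q' with hr
  have hrm : Measurable r := Measure.measurable_rnDeriv _ _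
  have hset : ∀ s, ∫⁻ x in s, r x ∂Q' = Q s := fun s ↦ Measure.setLIntegral_rnDeriv hac s
  have hup : r ≤ᵐ[Q'] fun _ ↦ ((1 + η : ℝ≥0) : ℝ≥0∞) := by
    refine ae_le_of_forall_setLIntegral_le_of_sigmaFinite hrm fun s _ _ ↦ ?_
    rw [hset, setLIntegral_const]
    exact h s
  have hlow : (fun _ ↦ 1) ≤ᵐ[Q'] fun x ↦ ((1 + η : ℝ≥0) : ℝ≥0∞) * r x := by
    refine ae_le_of_forall_setLIntegral_le_of_sigmaFinite measurable_const fun s _ _ ↦ ?_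
    rw [lintegral_const_mul _ hrm, hset, setLIntegral_const, one_mul]
    exact h' s
  have hone : ∫⁻ x, r x ∂Q' = 1 := by
    have := hset Set.univ
    rwa [setLIntegral_univ, measure_univ] at this
  have hmom : ∫⁻ x, r x ^ 2 ∂Q' ≤ ((1 + η ^ 2 : ℝ≥0) : ℝ≥0∞) := by
    -- `(r - 1) ^ 2 ≤ η ^ 2`, expanded so that no term is subtracted in `ℝ≥0∞`
    have hpt : ∀ᵐ x ∂Q', r x ^ 2 + 1 ≤ 2 * r x + ((η ^ 2 : ℝ≥0) : ℝ≥0∞) := by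
      filter_upwards [hup, hlow] with x h1 h2
      have hfin : r x ≠ ∞ := ne_top_of_le_ne_top ENNReal.coe_ne_top h1
      generalize r x = y at h1 h2 hfin
      lift y to ℝ≥0 using hfin
      norm_cast at h1 h2 ⊢
      rw [← NNReal.coe_le_coe] at h1 h2 ⊢
      push_cast at h1 h2 ⊢
      have hη := η.2
      have hy := y.2
      have h3 : (1 : ℝ) - η ≤ y := by nlinarith
      nlinarith
    have hint := lintegral_mono_ae hpt
    rw [lintegral_add_right _ measurable_const, lintegral_add_right _ measurable_const,
      lintegral_const_mul _ hrm, hone] at hint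
    simp only [lintegral_const, measure_univ, mul_one] at hint
    refine ENNReal.le_of_add_le_add_right ENNReal.one_ne_top (hint.trans_eq ?_)
    push_cast
    ring
  calc (∫⁻ a, f a ∂Q) ^ 2 = (∫⁻ a, r a * f a ∂Q') ^ 2 := by
        rw [lintegral_rnDeriv_mul hac hf.aemeasurable]
    _ ≤ _ := sq_lintegral_mul_le Q' hrm hf
    _ ≤ _ := by gcongr

end NearlyEqual

/-! ### Outputs and transcripts -/

namespace Mechanism

variable {Z : Type*} [MeasurableSpace Z]

attribute [instance] Mechanism.markov

theorem measurable_snoc {n : ℕ} :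
    Measurable fun p : (Fin n → Z) × Z ↦ (Fin.snoc p.1 p.2 : Fin (n + 1) → Z) := by
  refine measurable_pi_iff.2 fun i ↦ ?_
  refine Fin.lastCases ?_ (fun i ↦ ?_) i
  · simpa using measurable_snd
  · simp only [Fin.snoc_castSucc]; fun_prop

instance (M : Mechanism Z) (μ : Measure Data) [IsProbabilityMeasure μ] (n : ℕ) :
    IsProbabilityMeasure (M.transcript μ n) := by
  induction n with
  | zero => exact inferInstanceAs (IsProbabilityMeasure (Measure.dirac _))
  | succ n ih => exact Measure.isProbabilityMeasure_map (measurable_snoc.comp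
      ((measurable_snd.comp measurable_fst).prodMk measurable_snd)).aemeasurable

/-- The law of the output of the user numbered `n` given the outputs `z` revealed before, when the
value of this user has law `μ`. -/
noncomputable def output (M : Mechanism Z) (μ : Measure Data) (n : ℕ) (z : Fin n → Z) : Measure Z :=
  μ.bind fun x ↦ M.channel n (x, z)

theorem measurable_channel_left (M : Mechanism Z) (n : ℕ) (z : Fin n → Z) :
    Measurable fun x ↦ M.channel n (x, z) :=
  (M.channel n).measurable.comp measurable_prodMk_right

instance (M : Mechanism Z) (μ : Measure Data) [IsProbabilityMeasure μ] (n : ℕ) (z : Fin n → Z) :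
    IsProbabilityMeasure (M.output μ n z) :=
  isProbabilityMeasure_bind (M.measurable_channel_left n z).aemeasurable
    (ae_of_all _ fun _ ↦ inferInstance)

theorem lintegral_output (M : Mechanism Z) (μ : Measure Data) (n : ℕ) (z : Fin n → Z)
    {f : Z → ℝ≥0∞} (hf : Measurable f) :
    ∫⁻ w, f w ∂M.output μ n z = ∫⁻ x, ∫⁻ w, f w ∂M.channel n (x, z) ∂μ :=
  Measure.lintegral_bind (M.measurable_channel_left n z).aemeasurable hf.aemeasurable

theorem measurable_lintegral_output (M : Mechanism Z) (μ : Measure Data) [SFinite μ] (n : ℕ)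
    {f : (Fin n → Z) × Z → ℝ≥0∞} (hf : Measurable f) :
    Measurable fun z ↦ ∫⁻ w, f (z, w) ∂M.output μ n z := by
  have h : ∀ z, ∫⁻ w, f (z, w) ∂M.output μ n z =
      ∫⁻ x, ∫⁻ w, f (z, w) ∂M.channel n (x, z) ∂μ := fun z ↦
    M.lintegral_output μ n z (hf.comp measurable_prodMk_left)
  simp_rw [h]
  have hg : Measurable fun p : Data × (Fin n → Z) ↦ ∫⁻ w, f (p.2, w) ∂M.channel n p :=
    Measurable.lintegral_kernel_prod_right' (κ := M.channel n)
      (f := fun q : (Data × (Fin n → Z)) × Z ↦ f (q.1.2, q.2)) (by fun_prop)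
  exact hg.lintegral_prod_left'

theorem lintegral_transcript_succ (M : Mechanism Z) (μ : Measure Data) [IsProbabilityMeasure μ]
    (n : ℕ) {f : (Fin (n + 1) → Z) → ℝ≥0∞} (hf : Measurable f) :
    ∫⁻ z, f z ∂M.transcript μ (n + 1) =
      ∫⁻ z, ∫⁻ w, f (Fin.snoc z w) ∂M.output μ n z ∂M.transcript μ n := by
  have hs : Measurable fun p : (Data × (Fin n → Z)) × Z ↦
      (Fin.snoc p.1.2 p.2 : Fin (n + 1) → Z) :=
    measurable_snoc.comp ((measurable_snd.comp measurable_fst).prodMk measurable_snd)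
  have hg : Measurable fun p : Data × (Fin n → Z) ↦
      ∫⁻ w, f (Fin.snoc p.2 w) ∂M.channel n p :=
    Measurable.lintegral_kernel_prod_right' (κ := M.channel n)
      (f := fun q : (Data × (Fin n → Z)) × Z ↦ f (Fin.snoc q.1.2 q.2)) (hf.comp hs)
  rw [transcript, lintegral_map hf hs, Measure.lintegral_compProd (by exact hf.comp hs),
    lintegral_prod_symm' _ (by exact hg)]
  refine lintegral_congr fun z ↦ ?_
  exact (M.lintegral_output μ n z (hf.comp (measurable_snoc.comp measurable_prodMk_left))).symm

/-- First-moment comparison of the transcripts: a factor `1 + η` for every user. -/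
theorem lintegral_transcript_le (M : Mechanism Z) (μ μ' : Measure Data) [IsProbabilityMeasure μ]
    [IsProbabilityMeasure μ'] {η : ℝ≥0}
    (h : ∀ n z, M.output μ n z ≤ (1 + η) • M.output μ' n z) (N : ℕ)
    {f : (Fin N → Z) → ℝ≥0∞} (hf : Measurable f) :
    ∫⁻ z, f z ∂M.transcript μ N ≤
      ((1 + η : ℝ≥0) : ℝ≥0∞) ^ N * ∫⁻ z, f z ∂M.transcript μ' N := by
  induction N with
  | zero => simp [transcript]
  | succ n ih =>
    have hfs : Measurable fun p : (Fin n → Z) × Z ↦ f (Fin.snoc p.1 p.2) :=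
      hf.comp measurable_snoc
    have hm' := M.measurable_lintegral_output μ' n hfs
    rw [M.lintegral_transcript_succ μ n hf, M.lintegral_transcript_succ μ' n hf]
    calc _ ≤ ∫⁻ z, ((1 + η : ℝ≥0) : ℝ≥0∞) *
          ∫⁻ w, f (Fin.snoc z w) ∂M.output μ' n z ∂M.transcript μ n := by
          refine lintegral_mono fun z ↦ (lintegral_mono' (h n z) le_rfl).trans_eq ?_
          rw [lintegral_smul_measure]; rfl
      _ ≤ _ := by
          rw [lintegral_const_mul _ hm', pow_succ', mul_assoc]
          gcongr
          exact ih hm'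

/-- Second-moment comparison of the transcripts: a factor `1 + η ^ 2` for every user. This bounds
the chi-square divergence between the two laws, in a form that needs no joint density. -/
theorem sq_lintegral_transcript_le (M : Mechanism Z) (μ μ' : Measure Data)
    [IsProbabilityMeasure μ] [IsProbabilityMeasure μ'] {η : ℝ≥0}
    (h : ∀ n z, M.output μ n z ≤ (1 + η) • M.output μ' n z)
    (h' : ∀ n z, M.output μ' n z ≤ (1 + η) • M.output μ n z) (N : ℕ)
    {f : (Fin N → Z) → ℝ≥0∞} (hf : Measurable f) :
    (∫⁻ z, f z ∂M.transcript μ N) ^ 2 ≤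
      ((1 + η ^ 2 : ℝ≥0) : ℝ≥0∞) ^ N * ∫⁻ z, f z ^ 2 ∂M.transcript μ' N := by
  induction N with
  | zero => simp [transcript, lintegral_dirac' _ hf, lintegral_dirac' _ (hf.pow_const 2)]
  | succ n ih =>
    have hfs : Measurable fun p : (Fin n → Z) × Z ↦ f (Fin.snoc p.1 p.2) :=
      hf.comp measurable_snoc
    have hm := M.measurable_lintegral_output μ n hfs
    have hm' := M.measurable_lintegral_output μ' n (hfs.pow_const 2)
    rw [M.lintegral_transcript_succ μ n hf, M.lintegral_transcript_succ μ' n (hf.pow_const 2)]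
    calc _ ≤ _ := ih hm
      _ ≤ ((1 + η ^ 2 : ℝ≥0) : ℝ≥0∞) ^ n * ∫⁻ z, ((1 + η ^ 2 : ℝ≥0) : ℝ≥0∞) *
          ∫⁻ w, f (Fin.snoc z w) ^ 2 ∂M.output μ' n z ∂M.transcript μ' n := by
          gcongr with z
          exact sq_lintegral_le_of_le_smul (h n z) (h' n z) (hfs.comp measurable_prodMk_left)
      _ = _ := by rw [lintegral_const_mul _ hm', pow_succ _ n, mul_assoc]

/-- The effect of local privacy on one output: if the values of a user under the two data laws
`ν.map f` and `ν.map f'` differ only on an event `T`, then the output laws agree up to the factor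
`1 + (exp ε - 1) * ν T`, and not only up to an additive error `ν T`. -/
theorem output_map_le (M : Mechanism Z) {δ : ℝ≥0}
    (hM : ∀ (n : ℕ) (x x' : Data) (z : Fin n → Z) (S : Set Z), MeasurableSet S →
      M.channel n (x, z) S ≤ ((1 + δ : ℝ≥0) : ℝ≥0∞) * M.channel n (x', z) S)
    {Ω : Type*} [MeasurableSpace Ω] {ν : Measure Ω} [IsProbabilityMeasure ν] {f f' : Ω → Data}
    (hf : Measurable f) (hf' : Measurable f') {T : Set Ω} (hT : MeasurableSet T)
    (hff' : ∀ ω ∉ T, f ω = f' ω) {τ : ℝ≥0} (hτ : ν T ≤ τ) (n : ℕ) (z : Fin n → Z) :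
    M.output (ν.map f) n z ≤ (1 + δ * τ) • M.output (ν.map f') n z := by
  refine Measure.le_iff.2 fun S hS ↦ ?_
  have happ : ∀ {g : Ω → Data}, Measurable g →
      M.output (ν.map g) n z S = ∫⁻ ω, M.channel n (g ω, z) S ∂ν := fun {g} hg ↦ by
    rw [output, Measure.bind_apply hS (M.measurable_channel_left n z).aemeasurable,
      lintegral_map (by exact (Measure.measurable_coe hS).comp (M.measurable_channel_left n z)) hg]
  -- the smallest probability of `S` over all values of the user
  set m : ℝ≥0∞ := ⨅ x, M.channel n (x, z) S with hm
  have hle : ∀ x, M.channel n (x, z) S ≤ m + δ * m := fun x ↦ by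
    have : M.channel n (x, z) S ≤ ((1 + δ : ℝ≥0) : ℝ≥0∞) * m := by
      rw [hm, ENNReal.mul_iInf_of_ne (by positivity) ENNReal.coe_ne_top]
      exact le_iInf fun x' ↦ hM n x x' z S hS
    refine this.trans_eq ?_
    push_cast
    ring
  have hm' : m ≤ ∫⁻ ω, M.channel n (f' ω, z) S ∂ν :=
    calc m = ∫⁻ _, m ∂ν := by simp
      _ ≤ _ := lintegral_mono fun ω ↦ iInf_le _ _
  have hpt : ∀ ω, M.channel n (f ω, z) S ≤
      M.channel n (f' ω, z) S + T.indicator (fun _ ↦ δ * m) ω := fun ω ↦ by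
    by_cases hω : ω ∈ T
    · rw [Set.indicator_of_mem hω]
      exact (hle _).trans (by gcongr; exact iInf_le _ _)
    · simp [Set.indicator_of_notMem hω, hff' ω hω]
  rw [Measure.smul_apply, happ hf, happ hf']
  calc _ ≤ _ := lintegral_mono hpt
    _ = ∫⁻ ω, M.channel n (f' ω, z) S ∂ν + δ * m * ν T := by
        rw [lintegral_add_right _ (measurable_const.indicator hT), lintegral_indicator_const hT]
    _ ≤ ∫⁻ ω, M.channel n (f' ω, z) S ∂ν
          + δ * (∫⁻ ω, M.channel n (f' ω, z) S ∂ν) * τ := by gcongr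
    _ = _ := by
        rw [ENNReal.smul_def, smul_eq_mul]
        push_cast
        ring

end Mechanism

/-! ### Two hypotheses -/

/-- Le Cam's two-point argument, with total variation replaced by a second-moment comparison. If the
estimate is within `Δ / 2` of `θ` with high probability under `P`, then with a probability bounded
below it is so under `P'` as well, and there it misses `θ'` by at least `Δ / 2`. -/
theorem ofReal_le_lintegral_abs_or {β : Type*} [MeasurableSpace β] {P P' : Measure β}
    [IsProbabilityMeasure P]
    (hP : ∀ f : β → ℝ≥0∞, Measurable f → (∫⁻ z, f z ∂P) ^ 2 ≤ 3 * ∫⁻ z, f z ^ 2 ∂P')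
    {est : β → ℝ} (hest : Measurable est) {θ θ' Δ : ℝ} (hΔ : 0 < Δ) (hθ : Δ ≤ |θ - θ'|) :
    ENNReal.ofReal (Δ / 16) ≤ ∫⁻ z, ENNReal.ofReal |θ - est z| ∂P ∨
      ENNReal.ofReal (Δ / 16) ≤ ∫⁻ z, ENNReal.ofReal |θ' - est z| ∂P' := by
  by_cases hlt : ENNReal.ofReal (Δ / 16) ≤ ∫⁻ z, ENNReal.ofReal |θ - est z| ∂P
  · exact Or.inl hlt
  refine Or.inr ?_
  rw [not_le] at hlt
  have hmeas : ∀ t, Measurable fun z ↦ ENNReal.ofReal |t - est z| := fun t ↦ by fun_prop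
  set S : Set β := {z | ENNReal.ofReal (Δ / 2) ≤ ENNReal.ofReal |θ - est z|} with hS
  have hSm : MeasurableSet S := measurableSet_le measurable_const (hmeas θ)
  have hPS : P S ≤ ENNReal.ofReal (1 / 8) := by
    have hmk := (mul_meas_ge_le_lintegral (μ := P) (hmeas θ) (ENNReal.ofReal (Δ / 2))).trans hlt.le
    have h2 : ENNReal.ofReal (Δ / 16) = ENNReal.ofReal (Δ / 2) * ENNReal.ofReal (1 / 8) := by
      rw [← ENNReal.ofReal_mul (by positivity)]; congr 1; ring
    rw [h2] at hmk
    exact (ENNReal.mul_le_mul_iff_right (by simpa using hΔ) ENNReal.ofReal_ne_top).1 hmk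
  have hPSc : ENNReal.ofReal (7 / 8) ≤ P Sᶜ := by
    have h1 : P S + P Sᶜ = 1 := prob_add_prob_compl hSm
    have h2 : ENNReal.ofReal (1 / 8) + ENNReal.ofReal (7 / 8) = 1 := by
      rw [← ENNReal.ofReal_add (by norm_num) (by norm_num)]; norm_num
    refine ENNReal.le_of_add_le_add_left (a := ENNReal.ofReal (1 / 8)) ENNReal.ofReal_ne_top ?_
    rw [h2, ← h1]
    gcongr
  have hsq : P Sᶜ ^ 2 ≤ 3 * P' Sᶜ := by
    have h := hP (Sᶜ.indicator 1) (measurable_one.indicator hSm.compl)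
    have hi : (fun z ↦ Sᶜ.indicator (1 : β → ℝ≥0∞) z ^ 2) = Sᶜ.indicator 1 := by
      ext z; by_cases hz : z ∈ Sᶜ <;> simp [hz]
    rwa [hi, lintegral_indicator_one hSm.compl, lintegral_indicator_one hSm.compl] at h
  have hP'S : ENNReal.ofReal (1 / 4) ≤ P' Sᶜ := by
    have h1 : (3 : ℝ≥0∞) * ENNReal.ofReal (1 / 4) ≤ 3 * P' Sᶜ := by
      refine le_trans ?_ ((pow_le_pow_left' hPSc 2).trans hsq)
      rw [← ENNReal.ofReal_pow (by norm_num), ← ENNReal.ofReal_ofNat,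
        ← ENNReal.ofReal_mul (by norm_num)]
      exact ENNReal.ofReal_le_ofReal (by norm_num)
    exact (ENNReal.mul_le_mul_iff_right (by norm_num) (by norm_num)).1 h1
  have hfar : ∀ z ∈ Sᶜ, ENNReal.ofReal (Δ / 2) ≤ ENNReal.ofReal |θ' - est z| := fun z hz ↦ by
    refine ENNReal.ofReal_le_ofReal ?_
    have h1 : |θ - est z| < Δ / 2 := by
      by_contra hcon
      exact hz (ENNReal.ofReal_le_ofReal (not_lt.1 hcon))
    have h2 : |θ - θ'| ≤ |θ - est z| + |est z - θ'| := abs_sub_le _ _ _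
    rw [abs_sub_comm θ' (est z)]
    linarith
  calc ENNReal.ofReal (Δ / 16) ≤ ENNReal.ofReal (Δ / 2) * ENNReal.ofReal (1 / 4) := by
        rw [← ENNReal.ofReal_mul (by positivity)]
        exact ENNReal.ofReal_le_ofReal (by linarith)
    _ ≤ ENNReal.ofReal (Δ / 2) * P' Sᶜ := by gcongr
    _ = ∫⁻ _ in Sᶜ, ENNReal.ofReal (Δ / 2) ∂P' := (setLIntegral_const _ _).symm
    _ ≤ ∫⁻ z in Sᶜ, ENNReal.ofReal |θ' - est z| ∂P' := setLIntegral_mono' hSm.compl hfar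
    _ ≤ _ := setLIntegral_le_lintegral _ _

end LocalMin

namespace LocalMin

/-! ### Data laws indexed by binary digits -/

/-- The probability of `{j, j + 1, …}` under the geometric law. -/
theorem geometricMeasure_Ici {p : unitInterval} (hp : p ≠ 0) (j : ℕ) :
    geometricMeasure p (Set.Ici j) = ENNReal.ofReal ((1 - p) ^ j) := by
  have hq : (0 : ℝ) ≤ 1 - p := sub_nonneg.2 p.2.2
  induction j with
  | zero => simp [show (Set.Ici 0 : Set ℕ) = Set.univ from Set.Ici_bot]
  | succ j ih =>
    have hsplit : (Set.Ici j : Set ℕ) = {j} ∪ Set.Ici (j + 1) := by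
      ext i; simp only [Set.mem_Ici, Set.mem_union, Set.mem_singleton_iff]; omega
    have hdisj : Disjoint ({j} : Set ℕ) (Set.Ici (j + 1)) := by simp
    rw [hsplit, measure_union hdisj measurableSet_Ici, geometricMeasure_singleton hp] at ih
    have hsum : ENNReal.ofReal ((1 - p : ℝ) ^ j) =
        ENNReal.ofReal ((1 - p) ^ j * p) + ENNReal.ofReal ((1 - p) ^ (j + 1)) := by
      rw [← ENNReal.ofReal_add (geometricMeasure_nonneg p j) (by positivity)]
      congr 1; ring
    rw [hsum] at ih
    exact (ENNReal.add_right_inj ENNReal.ofReal_ne_top).1 ih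

/-- The right end of the dyadic interval of level `i` that contains the real number with binary
digits `b`, in `[0, 1]` scaled by `s`. It depends on the first `i` digits only. -/
noncomputable def rightEnd (s : ℝ) (b : ℕ → Fin 2) (i : ℕ) : ℝ :=
  s * (∑ k ∈ Finset.range i, Real.ofDigitsTerm b k + (2 ^ i)⁻¹)

theorem le_rightEnd {s : ℝ} (hs : 0 ≤ s) (b : ℕ → Fin 2) (i : ℕ) :
    s * Real.ofDigits b ≤ rightEnd s b i := by
  rw [rightEnd, Real.ofDigits_eq_sum_add_ofDigits b i]
  gcongr
  push_cast
  exact mul_le_of_le_one_right (by positivity) (Real.ofDigits_le_one _)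

theorem rightEnd_le {s : ℝ} (hs : 0 ≤ s) (b : ℕ → Fin 2) (i : ℕ) :
    rightEnd s b i ≤ s * Real.ofDigits b + s * (1 / 2) ^ i := by
  rw [rightEnd, Real.ofDigits_eq_sum_add_ofDigits b i, ← mul_add]
  gcongr
  · have := Real.ofDigits_nonneg (fun k ↦ b (k + i))
    have : (0 : ℝ) ≤ (((2 : ℕ) : ℝ) ^ i)⁻¹ * Real.ofDigits (fun k ↦ b (k + i)) := by positivity
    linarith
  · simp

theorem rightEnd_congr {s : ℝ} {b b' : ℕ → Fin 2} {J i : ℕ} (h : ∀ k < J, b k = b' k)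
    (hi : i ≤ J) : rightEnd s b i = rightEnd s b' i := by
  rw [rightEnd, rightEnd, Finset.sum_congr rfl fun k hk ↦ ?_]
  rw [Real.ofDigitsTerm, Real.ofDigitsTerm, h k ((Finset.mem_range.1 hk).trans_le hi)]

/-- The point `rightEnd s b i` as a value of a user. For `s ∈ [0, 1 / 2]` it lies in `[-1, 1]`, and
the projection to this interval does not change it. -/
noncomputable def rightEndData (s : ℝ) (b : ℕ → Fin 2) (i : ℕ) : Data :=
  Set.projIcc (-1) 1 (by norm_num) (rightEnd s b i)

theorem coe_rightEndData {s : ℝ} (hs : s ∈ Set.Ioc (0 : ℝ) (1 / 2)) (b : ℕ → Fin 2) (i : ℕ) :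
    (rightEndData s b i : ℝ) = rightEnd s b i := by
  have h0 := Real.ofDigits_nonneg b
  have h1 := Real.ofDigits_le_one b
  have hle := le_rightEnd hs.1.le b i
  have hge := rightEnd_le hs.1.le b i
  have hpow : (1 / 2 : ℝ) ^ i ≤ 1 := pow_le_one₀ (by norm_num) (by norm_num)
  have := mul_nonneg hs.1.le h0
  have := mul_le_of_le_one_right hs.1.le h1
  have := mul_le_of_le_one_right hs.1.le hpow
  have := hs.2
  rw [rightEndData, Set.projIcc_of_mem _ ⟨by linarith, by linarith⟩]

/-- The law of the dyadic right end of a random, geometrically distributed level. Its minimum is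
the real number with binary digits `b` (scaled by `s`), and changing the digits from the `J`-th one
on moves a mass `(1 - p) ^ (J + 1)` only. -/
noncomputable def dyadicLaw (p : unitInterval) (s : ℝ) (b : ℕ → Fin 2) : Measure Data :=
  (geometricMeasure p).map (rightEndData s b)

instance (p : unitInterval) (s : ℝ) (b : ℕ → Fin 2) : IsProbabilityMeasure (dyadicLaw p s b) :=
  Measure.isProbabilityMeasure_map Measurable.of_discrete.aemeasurable

theorem dataCDF_dyadicLaw (p : unitInterval) {s : ℝ} (hs : s ∈ Set.Ioc (0 : ℝ) (1 / 2))
    (b : ℕ → Fin 2) (x : ℝ) :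
    dataCDF (dyadicLaw p s b) x = (geometricMeasure p).real {i | rightEnd s b i ≤ x} := by
  have : IsProbabilityMeasure ((dyadicLaw p s b).map (Subtype.val : Data → ℝ)) :=
    Measure.isProbabilityMeasure_map measurable_subtype_coe.aemeasurable
  rw [dataCDF, cdf_eq_real, map_measureReal_apply measurable_subtype_coe measurableSet_Iic,
    dyadicLaw, map_measureReal_apply Measurable.of_discrete
      (measurable_subtype_coe measurableSet_Iic)]
  congr 1
  ext i
  simp [coe_rightEndData hs]

theorem pow_le_dataCDF_dyadicLaw {p : unitInterval} (hp : p ≠ 0) {s : ℝ}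
    (hs : s ∈ Set.Ioc (0 : ℝ) (1 / 2)) (b : ℕ → Fin 2) (j : ℕ) {x : ℝ}
    (hx : s * Real.ofDigits b + s * (1 / 2) ^ j ≤ x) :
    (1 - p : ℝ) ^ j ≤ dataCDF (dyadicLaw p s b) x := by
  have hq : (0 : ℝ) ≤ 1 - p := sub_nonneg.2 p.2.2
  have hj : (geometricMeasure p).real (Set.Ici j) = (1 - p) ^ j := by
    rw [measureReal_def, geometricMeasure_Ici hp, ENNReal.toReal_ofReal (by positivity)]
  rw [dataCDF_dyadicLaw p hs, ← hj]
  refine measureReal_mono fun i hi ↦ (rightEnd_le hs.1.le b i).trans (le_trans ?_ hx)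
  have hpow : (1 / 2 : ℝ) ^ i ≤ (1 / 2) ^ j := pow_le_pow_of_le_one (by norm_num) (by norm_num) hi
  have hs0 := hs.1.le
  gcongr

theorem exists_pow_near {s y : ℝ} (hs : 0 < s) (hy : 0 < y) (hys : y ≤ s) :
    ∃ j : ℕ, s * (1 / 2) ^ (j + 1) < y ∧ y ≤ s * (1 / 2) ^ j := by
  obtain ⟨j, h1, h2⟩ := exists_nat_pow_near_of_lt_one (div_pos hy hs) ((div_le_one hs).2 hys)
    (show (0 : ℝ) < 1 / 2 by norm_num) (by norm_num)
  exact ⟨j, by rwa [lt_div_iff₀ hs, mul_comm] at h1, by rwa [div_le_iff₀ hs, mul_comm] at h2⟩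

theorem xMin_dyadicLaw {p : unitInterval} (hp : p ≠ 0) (hp1 : p ≠ 1) {s : ℝ}
    (hs : s ∈ Set.Ioc (0 : ℝ) (1 / 2)) (b : ℕ → Fin 2) :
    xMin (dyadicLaw p s b) = s * Real.ofDigits b := by
  have hq : (0 : ℝ) < 1 - p := sub_pos.2 (unitInterval.lt_one_iff_ne_one.2 hp1)
  have h0 : 0 ≤ s * Real.ofDigits b := mul_nonneg hs.1.le (Real.ofDigits_nonneg b)
  have h1 : s * Real.ofDigits b ≤ s := mul_le_of_le_one_right hs.1.le (Real.ofDigits_le_one b)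
  have hs2 := hs.2
  have hmem : ∀ j : ℕ, s * Real.ofDigits b + s * (1 / 2) ^ j ∈
      {x : ℝ | x ∈ Set.Icc (-1 : ℝ) 1 ∧ 0 < dataCDF (dyadicLaw p s b) x} := fun j ↦ by
    have hj : s * (1 / 2) ^ j ≤ s :=
      mul_le_of_le_one_right hs.1.le (pow_le_one₀ (by norm_num) (by norm_num))
    have hj0 : 0 ≤ s * (1 / 2) ^ j := mul_nonneg hs.1.le (by positivity)
    exact ⟨⟨by linarith, by linarith⟩,
      (pow_pos hq j).trans_le (pow_le_dataCDF_dyadicLaw hp hs b j le_rfl)⟩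
  refine csInf_eq_of_forall_ge_of_forall_gt_exists_lt ⟨_, hmem 0⟩ (fun x hx ↦ ?_) fun w hw ↦ ?_
  · by_contra! hlt
    have hempty : {i | rightEnd s b i ≤ x} = ∅ := by
      ext i
      simpa using hlt.trans_le (le_rightEnd hs.1.le b i)
    have := hx.2
    rw [dataCDF_dyadicLaw p hs, hempty] at this
    simp at this
  · obtain ⟨j, hj⟩ := exists_pow_lt_of_lt_one (div_pos (sub_pos.2 hw) hs.1)
      (show (1 / 2 : ℝ) < 1 by norm_num)
    refine ⟨_, hmem j, ?_⟩
    rw [lt_div_iff₀ hs.1] at hj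
    linarith

theorem isFat_dyadicLaw {α C : ℝ} (hα : 0 < α) (hC : 0 < C) {p : unitInterval} (hp : p ≠ 0)
    (hpα : (1 - p : ℝ) = (1 / 2) ^ α) {s : ℝ} (hs : s ∈ Set.Ioc (0 : ℝ) (1 / 2))
    (hCs : C * s ^ α ≤ (1 / 2) ^ α) (b : ℕ → Fin 2) :
    IsFat α C (xMin (dyadicLaw p s b) + s) (dyadicLaw p s b) := by
  have hp1 : p ≠ 1 := by
    rintro rfl
    have : (0 : ℝ) < (1 / 2) ^ α := by positivity
    simp at hpα
    linarith
  have h0 : 0 ≤ s * Real.ofDigits b := mul_nonneg hs.1.le (Real.ofDigits_nonneg b)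
  have h1 : s * Real.ofDigits b ≤ s := mul_le_of_le_one_right hs.1.le (Real.ofDigits_le_one b)
  have hs1 := hs.1
  have hs2 := hs.2
  rw [xMin_dyadicLaw hp hp1 hs]
  refine ⟨hα, hC, ⟨by linarith, by linarith⟩, ?_, fun x hx hxs ↦ ?_⟩
  · rw [xMin_dyadicLaw hp hp1 hs]; linarith
  rw [xMin_dyadicLaw hp hp1 hs] at hx ⊢
  obtain ⟨j, hj1, hj2⟩ := exists_pow_near hs1 (sub_pos.2 hx) (by linarith)
  calc C * (x - s * Real.ofDigits b) ^ α ≤ C * (s * (1 / 2) ^ j) ^ α := by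
        gcongr
    _ = C * s ^ α * ((1 / 2) ^ α) ^ j := by
        rw [Real.mul_rpow hs1.le (by positivity), ← Real.rpow_natCast, ← Real.rpow_mul (by norm_num),
          ← Real.rpow_natCast, ← Real.rpow_mul (by norm_num), mul_comm (j : ℝ), mul_assoc]
    _ ≤ (1 / 2) ^ α * ((1 / 2) ^ α) ^ j := by gcongr
    _ = (1 - p) ^ (j + 1) := by rw [hpα, pow_succ']
    _ ≤ _ := pow_le_dataCDF_dyadicLaw hp hs b (j + 1) (by linarith)

/-- The digits `b` with the `j`-th one replaced by the other digit. -/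
def flipDigit (b : ℕ → Fin 2) (j : ℕ) : ℕ → Fin 2 :=
  Function.update b j (1 - b j)

theorem flipDigit_of_ne {b : ℕ → Fin 2} {j k : ℕ} (h : k ≠ j) : flipDigit b j k = b k :=
  Function.update_of_ne h _ _

theorem abs_ofDigits_sub_flipDigit (b : ℕ → Fin 2) (j : ℕ) :
    |Real.ofDigits b - Real.ofDigits (flipDigit b j)| = (1 / 2) ^ (j + 1) := by
  have hsum : ∑ k ∈ Finset.range j, Real.ofDigitsTerm (flipDigit b j) k =
      ∑ k ∈ Finset.range j, Real.ofDigitsTerm b k :=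
    Finset.sum_congr rfl fun k hk ↦ by
      rw [Real.ofDigitsTerm, Real.ofDigitsTerm, flipDigit_of_ne (Finset.mem_range.1 hk).ne]
  have htail : (fun k ↦ flipDigit b j (k + (j + 1))) = fun k ↦ b (k + (j + 1)) :=
    funext fun k ↦ flipDigit_of_ne (by omega)
  have hdig : |((b j : ℕ) : ℝ) - ((1 - b j : Fin 2) : ℕ)| = 1 := by
    generalize b j = d
    fin_cases d <;> simp
  rw [Real.ofDigits_eq_sum_add_ofDigits b (j + 1),
    Real.ofDigits_eq_sum_add_ofDigits (flipDigit b j) (j + 1), htail, Finset.sum_range_succ,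
    Finset.sum_range_succ, hsum, Real.ofDigitsTerm, Real.ofDigitsTerm, add_sub_add_right_eq_sub,
    add_sub_add_left_eq_sub, ← sub_mul, abs_mul, flipDigit, Function.update_self, hdig]
  simp

theorem tendsto_flipDigit (b : ℕ → Fin 2) : Tendsto (flipDigit b) atTop (nhds b) := by
  refine tendsto_pi_nhds.2 fun k ↦ tendsto_const_nhds.congr' ?_
  filter_upwards [eventually_gt_atTop k] with j hj
  exact (flipDigit_of_ne hj.ne).symm

/-! ### The error on the dyadic laws -/

namespace Mechanism

variable {Z : Type*} [MeasurableSpace Z]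

/-- The deviation of the output laws of an `ε`-private mechanism under two dyadic laws whose digits
agree below `J`. -/
noncomputable def outputGap (p : unitInterval) (ε : ℝ) (J : ℕ) : ℝ≥0 :=
  (Real.exp ε - 1).toNNReal * ((1 - p : ℝ) ^ (J + 1)).toNNReal

theorem output_dyadicLaw_le {M : Mechanism Z} {ε : ℝ} (hε : 0 ≤ ε) (hM : M.IsLDP ε)
    {p : unitInterval} (hp : p ≠ 0) (s : ℝ) {b b' : ℕ → Fin 2} {J : ℕ}
    (h : ∀ k < J, b k = b' k) (n : ℕ) (z : Fin n → Z) :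
    M.output (dyadicLaw p s b) n z ≤ (1 + outputGap p ε J) • M.output (dyadicLaw p s b') n z := by
  refine M.output_map_le (fun n x x' z S hS ↦ (hM n x x' z S hS).trans_eq ?_)
    Measurable.of_discrete Measurable.of_discrete (T := Set.Ici (J + 1)) measurableSet_Ici
    (fun i hi ↦ ?_) (geometricMeasure_Ici hp (J + 1)).le n z
  · congr 1
    have h1 : (0 : ℝ) ≤ Real.exp ε - 1 := sub_nonneg.2 (Real.one_le_exp hε)
    rw [← Real.toNNReal_one, ← Real.toNNReal_add zero_le_one h1, add_sub_cancel]
    rfl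
  · rw [rightEndData, rightEndData, rightEnd_congr h (by simpa using hi)]

/-- Flipping one digit moves the minimum, but the transcripts of the two laws remain hard to tell
apart as long as the deviations of all outputs are square-summable to at most `1`. -/
theorem err_dyadicLaw_or_err_flipDigit {M : Mechanism Z} {ε : ℝ}
    (hε : ε ∈ Set.Icc (0 : ℝ) (22 / 35)) (hM : M.IsLDP ε) {p : unitInterval} (hp : p ≠ 0)
    (hp1 : p ≠ 1) {s : ℝ} (hs : s ∈ Set.Ioc (0 : ℝ) (1 / 2)) {N j : ℕ}
    (hj : 4 * (ε ^ 2 * N) * ((1 - p : ℝ) ^ 2) ^ (j + 1) ≤ 1) {est : (Fin N → Z) → ℝ}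
    (hest : Measurable est) (b : ℕ → Fin 2) :
    ENNReal.ofReal (s / 32 * (1 / 2) ^ j) ≤ M.err (dyadicLaw p s b) est ∨
      ENNReal.ofReal (s / 32 * (1 / 2) ^ j) ≤ M.err (dyadicLaw p s (flipDigit b j)) est := by
  have hagree : ∀ k < j, b k = flipDigit b j k := fun k hk ↦ (flipDigit_of_ne hk.ne).symm
  have hconst : ((1 + outputGap p ε j ^ 2 : ℝ≥0) : ℝ≥0∞) ^ N ≤ 3 := by
    have hq : (0 : ℝ) ≤ 1 - p := sub_nonneg.2 p.2.2
    have hexp1 : 0 ≤ Real.exp ε - 1 := sub_nonneg.2 (Real.one_le_exp hε.1)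
    have hexp2 : Real.exp ε - 1 ≤ 2 * ε := by
      have h1 := Real.abs_exp_sub_one_sub_id_le (x := ε)
        (by rw [abs_of_nonneg hε.1]; linarith [hε.2])
      have h2 := (abs_le.1 h1).2
      nlinarith [hε.1, hε.2]
    have hgap : (outputGap p ε j : ℝ) ^ 2 ≤ 4 * ε ^ 2 * ((1 - p : ℝ) ^ 2) ^ (j + 1) := by
      rw [outputGap, NNReal.coe_mul, Real.coe_toNNReal _ hexp1, Real.coe_toNNReal _ (by positivity),
        mul_pow, ← pow_mul, ← pow_mul, mul_comm (j + 1)]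
      gcongr
      nlinarith
    have hreal : (1 + (outputGap p ε j : ℝ) ^ 2) ^ N ≤ 3 :=
      calc (1 + (outputGap p ε j : ℝ) ^ 2) ^ N
          ≤ (1 + 4 * ε ^ 2 * ((1 - p : ℝ) ^ 2) ^ (j + 1)) ^ N := by gcongr
        _ ≤ Real.exp (4 * ε ^ 2 * ((1 - p : ℝ) ^ 2) ^ (j + 1)) ^ N := by
            gcongr
            rw [add_comm]
            exact Real.add_one_le_exp _
        _ = Real.exp (4 * (ε ^ 2 * N) * ((1 - p : ℝ) ^ 2) ^ (j + 1)) := by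
            rw [← Real.exp_nat_mul]; congr 1; ring
        _ ≤ Real.exp 1 := Real.exp_le_exp.2 hj
        _ ≤ 3 := Real.exp_one_lt_three.le
    exact_mod_cast hreal
  have htwo := ofReal_le_lintegral_abs_or (P := M.transcript (dyadicLaw p s b) N)
    (P' := M.transcript (dyadicLaw p s (flipDigit b j)) N)
    (θ := s * Real.ofDigits b) (θ' := s * Real.ofDigits (flipDigit b j))
    (Δ := s * (1 / 2) ^ (j + 1))
    (fun f hf ↦ (M.sq_lintegral_transcript_le _ _
      (output_dyadicLaw_le hε.1 hM hp s hagree)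
      (output_dyadicLaw_le hε.1 hM hp s fun k hk ↦ (hagree k hk).symm) N hf).trans
        (by gcongr)) hest (by have := hs.1; positivity)
    (by rw [← mul_sub, abs_mul, abs_of_pos hs.1, abs_ofDigits_sub_flipDigit])
  rw [err, err, xMin_dyadicLaw hp hp1 hs, xMin_dyadicLaw hp hp1 hs,
    show s / 32 * (1 / 2) ^ j = s * (1 / 2) ^ (j + 1) / 16 by ring]
  exact htwo

/-- The error is lower semicontinuous in the digits: both the minimum and the law of the transcript
depend continuously on them, the latter in the strong sense of likelihood ratios close to `1`. -/
theorem isClosed_err_dyadicLaw_le {M : Mechanism Z} {ε : ℝ} (hε : 0 ≤ ε) (hM : M.IsLDP ε)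
    {p : unitInterval} (hp : p ≠ 0) (hp1 : p ≠ 1) {s : ℝ} (hs : s ∈ Set.Ioc (0 : ℝ) (1 / 2))
    {N : ℕ} {est : (Fin N → Z) → ℝ} (hest : Measurable est) (t : ℝ≥0∞) :
    IsClosed {b | M.err (dyadicLaw p s b) est ≤ t} := by
  refine isClosed_of_closure_subset fun b hb ↦ ?_
  have hJ : ∀ J : ℕ, M.err (dyadicLaw p s b) est ≤
      ((1 + outputGap p ε J : ℝ≥0) : ℝ≥0∞) ^ N * (ENNReal.ofReal (s * (1 / 2) ^ J) + t) := by
    intro J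
    obtain ⟨b', hb', hbt⟩ := mem_closure_iff.1 hb _ (PiNat.isOpen_cylinder _ b J)
      (PiNat.self_mem_cylinder b J)
    have hagree : ∀ k < J, b k = b' k := fun k hk ↦ (PiNat.mem_cylinder_iff.1 hb' k hk).symm
    refine (M.lintegral_transcript_le _ _ (output_dyadicLaw_le hε hM hp s hagree) N
      (by fun_prop)).trans ?_
    gcongr
    refine le_trans ?_ (add_le_add_right (show M.err (dyadicLaw p s b') est ≤ t from hbt) _)
    rw [err, xMin_dyadicLaw hp hp1 hs, xMin_dyadicLaw hp hp1 hs]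
    have hd : |s * Real.ofDigits b - s * Real.ofDigits b'| ≤ s * (1 / 2) ^ J := by
      rw [← mul_sub, abs_mul, abs_of_pos hs.1]
      have := Real.abs_ofDigits_sub_ofDigits_le hagree
      have hs0 := hs.1.le
      gcongr
      simpa using this
    calc _ ≤ ∫⁻ z, (ENNReal.ofReal (s * (1 / 2) ^ J)
          + ENNReal.ofReal |s * Real.ofDigits b' - est z|) ∂M.transcript (dyadicLaw p s b') N := by
          refine lintegral_mono fun z ↦ ?_
          rw [← ENNReal.ofReal_add (mul_nonneg hs.1.le (by positivity)) (abs_nonneg _)]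
          exact ENNReal.ofReal_le_ofReal ((abs_sub_le _ _ _).trans (by gcongr))
      _ = _ := by rw [lintegral_add_left measurable_const]; simp
  have hq0 : (0 : ℝ) ≤ 1 - p := sub_nonneg.2 p.2.2
  have hq1 : (1 - p : ℝ) < 1 := sub_lt_self 1 (unitInterval.pos_iff_ne_zero.2 hp)
  have hgap : Tendsto (fun J ↦ outputGap p ε J) atTop (nhds 0) := by
    have h1 := ((tendsto_pow_atTop_nhds_zero_of_lt_one hq0 hq1).comp (tendsto_add_atTop_nat 1))
    have h2 := (tendsto_real_toNNReal h1).const_mul (Real.exp ε - 1).toNNReal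
    simpa [outputGap] using h2
  have hfac : Tendsto (fun J ↦ ((1 + outputGap p ε J : ℝ≥0) : ℝ≥0∞) ^ N) atTop (nhds 1) := by
    have h1 := ENNReal.tendsto_coe.2 ((hgap.const_add 1).pow N)
    simpa using h1
  have hadd : Tendsto (fun J : ℕ ↦ ENNReal.ofReal (s * (1 / 2) ^ J) + t) atTop (nhds t) := by
    have h1 : Tendsto (fun J : ℕ ↦ s * (1 / 2 : ℝ) ^ J) atTop (nhds 0) := by
      simpa using (tendsto_pow_atTop_nhds_zero_of_lt_one (r := (1 / 2 : ℝ)) (by norm_num)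
        (by norm_num)).const_mul s
    simpa using (ENNReal.tendsto_ofReal h1).add_const t
  have hlim := ENNReal.Tendsto.mul hfac (Or.inl one_ne_zero) hadd (Or.inr ENNReal.one_ne_top)
  rw [one_mul] at hlim
  exact ge_of_tendsto' hlim hJ

end Mechanism

/-- The scale at which a digit is flipped: fine enough for the two laws to be indistinguishable,
and no finer than that, up to the factor `(1 / 4) ^ (1 / (2 * α))`. -/
theorem exists_level {α : ℝ} (hα : 0 < α) (ε : ℝ) (N : ℕ) :
    ∃ j : ℕ, 4 * (ε ^ 2 * N) * (((1 / 2 : ℝ) ^ α) ^ 2) ^ (j + 1) ≤ 1 ∧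
      (1 / 4) ^ (1 / (2 * α)) * rate α ε N ≤ (1 / 2) ^ j := by
  set X : ℝ := max 1 (ε ^ 2 * N) with hX
  have hX1 : 1 ≤ X := le_max_left _ _
  have hX0 : 0 < X := by linarith
  have hq1 : ((1 / 2 : ℝ) ^ α) < 1 := Real.rpow_lt_one (by norm_num) (by norm_num) hα
  have hq0 : (0 : ℝ) < (1 / 2) ^ α := by positivity
  obtain ⟨j, h1, h2⟩ := exists_nat_pow_near_of_lt_one (x := 1 / (4 * X)) (by positivity)
    (by rw [div_le_one (by positivity)]; linarith) (pow_pos hq0 2)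
    (pow_lt_one₀ hq0.le hq1 two_ne_zero)
  refine ⟨j, ?_, ?_⟩
  · rw [lt_div_iff₀ (by positivity)] at h1
    calc 4 * (ε ^ 2 * N) * (((1 / 2 : ℝ) ^ α) ^ 2) ^ (j + 1)
        ≤ 4 * X * (((1 / 2 : ℝ) ^ α) ^ 2) ^ (j + 1) := by gcongr; exact le_max_right _ _
      _ ≤ 1 := by linarith
  · calc (1 / 4) ^ (1 / (2 * α)) * rate α ε N = (1 / (4 * X)) ^ (1 / (2 * α)) := by
          rw [rate, ← Real.mul_rpow (by norm_num) (by positivity), ← hX]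
          congr 1
          field_simp
      _ ≤ ((((1 / 2 : ℝ) ^ α) ^ 2) ^ j) ^ (1 / (2 * α)) := by gcongr
      _ = (1 / 2) ^ j := by
          rw [← pow_mul, ← Real.rpow_natCast, ← Real.rpow_mul hq0.le,
            ← Real.rpow_mul (by norm_num), ← Real.rpow_natCast]
          congr 1
          push_cast
          field_simp

/-- Passage from the two-point bounds to a single point of Cantor space. `E k b` stands for the
error of the `k`-th estimator at `b`, and `j k` for the digit whose flip it cannot detect. -/
theorem exists_frequently_le_of_flipDigit {E : ℕ → (ℕ → Fin 2) → ℝ≥0∞} {t t' : ℕ → ℝ≥0∞} {j : ℕ → ℕ}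
    (hclosed : ∀ k, IsClosed {b | E k b ≤ t k}) (ht : ∀ k, t k < t' k)
    (hflip : ∀ k b, t' k ≤ E k b ∨ t' k ≤ E k (flipDigit b (j k))) :
    ∃ b, ∃ᶠ k in atTop, t k ≤ E k b := by
  by_cases hJ : ∃ J, ∃ᶠ k in atTop, j k = J
  · -- one and the same pair of points serves infinitely many `k`
    obtain ⟨J, hJ⟩ := hJ
    have hor : ∃ᶠ k in atTop, t k ≤ E k 0 ∨ t k ≤ E k (flipDigit 0 J) :=
      hJ.mono fun k hk ↦ hk ▸ (hflip k 0).imp (ht k).le.trans (ht k).le.trans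
    rcases frequently_or_distrib.1 hor with h | h
    · exact ⟨_, h⟩
    · exact ⟨_, h⟩
  · simp only [not_exists, not_frequently] at hJ
    have hjtop : Tendsto j atTop atTop := by
      refine tendsto_atTop.2 fun J ↦ ?_
      filter_upwards [(Finset.eventually_all (Finset.range J)).2 fun i _ ↦ hJ i] with k hk
      by_contra! hlt
      exact hk _ (Finset.mem_range.2 hlt) rfl
    by_contra! hcon
    -- by Baire, the errors are small from some `K` on throughout an open set of digits, which
    -- contains both `b` and `flipDigit b (j k)` for large `k`
    obtain ⟨K, b, hb⟩ := nonempty_interior_of_iUnion_of_closed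
      (f := fun K ↦ ⋂ k, ⋂ (_ : K ≤ k), {b | E k b ≤ t k})
      (fun K ↦ isClosed_iInter fun k ↦ isClosed_iInter fun _ ↦ hclosed k) (by
        refine Set.eq_univ_of_forall fun b ↦ ?_
        obtain ⟨K, hK⟩ := eventually_atTop.1 (hcon b)
        exact Set.mem_iUnion.2 ⟨K, Set.mem_iInter₂.2 fun k hk ↦ (hK k hk).le⟩)
    have hev := ((tendsto_flipDigit b).comp hjtop).eventually (isOpen_interior.mem_nhds hb)
    obtain ⟨k, hk, hKk⟩ := (hev.and (eventually_ge_atTop K)).exists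
    have h1 : E k b ≤ t k := Set.mem_iInter₂.1 (interior_subset hb) k hKk
    have h2 : E k (flipDigit b (j k)) ≤ t k := Set.mem_iInter₂.1 (interior_subset hk) k hKk
    rcases hflip k b with h | h
    · exact absurd (h.trans h1) (ht k).not_ge
    · exact absurd (h.trans h2) (ht k).not_ge

theorem rate_pos (α ε : ℝ) (N : ℕ) : 0 < rate α ε N :=
  Real.rpow_pos_of_pos (one_div_pos.2 (zero_lt_one.trans_le (le_max_left _ _))) _

end LocalMin

theorem theorem7 (α C : ℝ) (hα : 0 < α) (hC : 0 < C) :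
    ∃ c : ℝ, 0 < c ∧ ∃ h : ℝ, 0 < h ∧
      -- the minimax bound for every privacy level and every number of users
      (∀ (ε : ℝ) (_ : ε ∈ Set.Icc (0 : ℝ) (22 / 35)) (N : ℕ)
          (Z : Type u) [MeasurableSpace Z] (M : LocalMin.Mechanism Z) (_ : M.IsLDP ε)
          (est : (Fin N → Z) → ℝ) (_ : Measurable est),
        ∃ μ : ProbabilityMeasure LocalMin.Data,
          (∃ xbar : ℝ, LocalMin.xMin μ + h ≤ xbar ∧ LocalMin.IsFat α C xbar μ) ∧
          ENNReal.ofReal (c * LocalMin.rate α ε N) ≤ M.err (μ : Measure LocalMin.Data) est) ∧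
      -- one distribution for a whole sequence of numbers of users and privacy levels
      (∀ (ε : ℕ → ℝ) (_ : ∀ k, ε k ∈ Set.Icc (0 : ℝ) (22 / 35)) (N : ℕ → ℕ)
          (Z : ℕ → Type u) [∀ k, MeasurableSpace (Z k)]
          (M : ∀ k, LocalMin.Mechanism (Z k)) (_ : ∀ k, (M k).IsLDP (ε k))
          (est : ∀ k, (Fin (N k) → Z k) → ℝ) (_ : ∀ k, Measurable (est k)),
        ∃ μ : ProbabilityMeasure LocalMin.Data,
          (∃ xbar : ℝ, LocalMin.xMin μ + h ≤ xbar ∧ LocalMin.IsFat α C xbar μ) ∧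
          ∃ᶠ k in atTop, ENNReal.ofReal (c * LocalMin.rate α (ε k) (N k)) ≤
            (M k).err (μ : Measure LocalMin.Data) (est k)) := by
  have hq0 : (0 : ℝ) < (1 / 2) ^ α := by positivity
  have hq1 : (1 / 2 : ℝ) ^ α < 1 := Real.rpow_lt_one (by norm_num) (by norm_num) hα
  -- the level of an atom exceeds `j` with probability `((1 / 2) ^ α) ^ (j + 1)`
  obtain ⟨p, hpα⟩ : ∃ p : unitInterval, (1 - p : ℝ) = (1 / 2) ^ α :=
    ⟨⟨1 - (1 / 2) ^ α, by linarith, by linarith⟩, sub_sub_cancel _ _⟩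
  have hp : p ≠ 0 := by rintro rfl; simp at hpα; norm_num at hq1; linarith
  have hp1 : p ≠ 1 := by rintro rfl; simp at hpα; norm_num at hq0; linarith
  -- a scale so small that the geometric tails dominate `C * (x - xMin) ^ α`
  obtain ⟨s, hs, hCs⟩ : ∃ s ∈ Set.Ioc (0 : ℝ) (1 / 2), C * s ^ α ≤ (1 / 2) ^ α := by
    refine ⟨min (1 / 2) (((1 / 2) ^ α / C) ^ (1 / α)), ⟨by positivity, min_le_left _ _⟩, ?_⟩
    calc C * (min (1 / 2) (((1 / 2) ^ α / C) ^ (1 / α))) ^ α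
        ≤ C * ((((1 / 2) ^ α / C) ^ (1 / α)) ^ α) := by gcongr; exact min_le_right _ _
      _ = (1 / 2) ^ α := by
        rw [← Real.rpow_mul (by positivity), one_div_mul_cancel hα.ne', Real.rpow_one]
        field_simp
  have hs0 := hs.1
  set c : ℝ := s / 32 * (1 / 4) ^ (1 / (2 * α)) with hc
  have hc0 : 0 < c := by positivity
  let law (b : ℕ → Fin 2) : ProbabilityMeasure LocalMin.Data :=
    ⟨LocalMin.dyadicLaw p s b, inferInstance⟩
  have hfat : ∀ b, ∃ xbar : ℝ, LocalMin.xMin (law b) + s ≤ xbar ∧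
      LocalMin.IsFat α C xbar (law b) := fun b ↦
    ⟨_, le_rfl, LocalMin.isFat_dyadicLaw hα hC hp hpα hs hCs b⟩
  choose j hj hjrate using fun ε N ↦ LocalMin.exists_level hα ε N
  have hcj : ∀ ε N, c * LocalMin.rate α ε N ≤ s / 32 * (1 / 2) ^ j ε N := fun ε N ↦ by
    rw [hc, mul_assoc]
    gcongr
    exact hjrate ε N
  have hflip : ∀ (ε : ℝ) (_ : ε ∈ Set.Icc (0 : ℝ) (22 / 35)) (N : ℕ) (Z : Type u)
      [MeasurableSpace Z] (M : LocalMin.Mechanism Z) (_ : M.IsLDP ε) (est : (Fin N → Z) → ℝ)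
      (_ : Measurable est) (b : ℕ → Fin 2),
      ENNReal.ofReal (c * LocalMin.rate α ε N) ≤ M.err (law b) est ∨
        ENNReal.ofReal (c * LocalMin.rate α ε N) ≤
          M.err (law (LocalMin.flipDigit b (j ε N))) est := by
    intro ε hε N Z _ M hM est hest b
    have hle := ENNReal.ofReal_le_ofReal (hcj ε N)
    exact (LocalMin.Mechanism.err_dyadicLaw_or_err_flipDigit hε hM hp hp1 hs
      (by rw [hpα]; exact hj ε N) hest b).imp hle.trans hle.trans
  -- half the two-point constant, so that the exceptional sets below are given by strict inequality
  have hhalf : ∀ ε N, ENNReal.ofReal (c / 2 * LocalMin.rate α ε N) <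
      ENNReal.ofReal (c * LocalMin.rate α ε N) := fun ε N ↦ by
    have := LocalMin.rate_pos α ε N
    refine (ENNReal.ofReal_lt_ofReal_iff (by positivity)).2 ?_
    gcongr
    linarith
  refine ⟨c / 2, by positivity, s, hs0, ?_, ?_⟩
  · intro ε hε N Z _ M hM est hest
    rcases hflip ε hε N Z M hM est hest 0 with h | h
    · exact ⟨_, hfat _, (hhalf ε N).le.trans h⟩
    · exact ⟨_, hfat _, (hhalf ε N).le.trans h⟩
  · intro ε hε N Z _ M hM est hest
    obtain ⟨b, hb⟩ := LocalMin.exists_frequently_le_of_flipDigit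
      (E := fun k b ↦ (M k).err (law b) (est k)) (j := fun k ↦ j (ε k) (N k))
      (fun k ↦ LocalMin.Mechanism.isClosed_err_dyadicLaw_le (hε k).1 (hM k) hp hp1 hs (hest k) _)
      (fun k ↦ hhalf (ε k) (N k))
      (fun k b ↦ hflip (ε k) (hε k) (N k) (Z k) (M k) (hM k) (est k) (hest k) b)
    exact ⟨law b, hfat b, hb⟩
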